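/- **Theorem.** Let $\mathbb{K}$ be an algebraically closed field of characteristic zero, let $m\ge 1$ and $N=2m$. Let $A_N=\mathbb{K}[t_1^{\pm1},\dots,t_N^{\pm1}]$, $d_i=t_i\frac{\partial}{\partial t_i}$, and for $u\in\mathbb{K}^N$, $\mathbf r\in\mathbb{Z}^N$ put $D(u,\mathbf r)=\sum_{i=1}^N u_i\,t^{\mathbf r}d_i\in\operatorname{Der}_{\mathbb K}(A_N)$. For $\mathbf r\in\mathbb{Z}^N$ let $\overline{\mathbf r}=(r_{m+1},\dots,r_{2m},-r_1,\dots,-r_m)$ and $h_{\mathbf r}=D(\overline{\mathbf r},\mathbf r)$. Let $\mathfrak h=\{D(u,\mathbf 0)\mid u\in\mathbb{K}^N\}$, let $\mathcal H_N=\operatorname{span}_{\mathbb K}\{h_{\mathbf r}\mid \mathbf r\in\mathbb{Z}^N\}+\mathfrak h\subseteq\operatorname{Der}_{\mathbb K}(A_N)$ be the Hamiltonian Lie algebra, and let $\mathcal H_N'=[\mathcal H_N,\mathcal H_N]$, which is $\mathbb{Z}^N$-graded with components $(\mathcal H_N')_{\mathbf r}=\mathbb{K}h_{\mathbf r}$ (so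 $(\mathcal H_N')_{\mathbf 0}=0$). Let $\operatorname{Der}(\mathcal H_N')_{\mathbf r}$ be the space of derivations $\partial$ of $\mathcal H_N'$ with $\partial((\mathcal H_N')_{\mathbf s})\subseteq(\mathcal H_N')_{\mathbf r+\mathbf s}$ for all $\mathbf s\in\mathbb{Z}^N$. Then: 1. $\mathcal H_N=\mathcal H_N'\rtimes\mathfrak h$; that is, $(x,y)\mapsto x+y$ is a Lie algebra isomorphism from the semidirect product $\mathcal H_N'\rtimes\mathfrak h$ (for the adjoint action of $\mathfrak h$ on $\mathcal H_N'$) onto $\mathcal H_N$. 2. The adjoint action $x\mapsto \operatorname{ad}(x)|_{\mathcal H_N'}$ is a Lie algebra isomorphism $\mathcal H_N\cong\operatorname{Der}(\mathcal H_N')$. In particular every derivation of $\mathcal H_N'$ is of the form $y\mapsto[x,y]$ for some $x\in\mathcal H_N$, and $\operatorname{Der}(\mathcal H_N')\cong\mathcal H_N'\rtimes\mathfrak h\cong\mathcal H_N$. 3. For $\mathbf r\in\mathbb{Z}^N\setminus\{\mathbf 0\}$, $\operatorname{Der}(\mathcal H_N')_{\mathbf r}=\operatorname{ad}\big((\mathcal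 H_N')_{\mathbf r}\big)$; in particular derivations of nonzero degree are inner. 4. $\operatorname{Der}(\mathcal H_N')_{\mathbf 0}=\{\operatorname{ad}(x)|_{\mathcal H_N'}\mid x\in\mathfrak h\}$. -/

import Mathlib

noncomputable section

namespace HamTorus

/-- The index set `{1, …, N}`, `N = 2m`: `Sum.inl i` stands for `i` and `Sum.inr i` for `m + i`. -/
abbrev Idx (m : ℕ) : Type := Fin m ⊕ Fin m

/-- The Laurent polynomial algebra `A_N = 𝕂[t₁^{±1}, …, t_N^{±1}]`, `N = 2m`,
as the group algebra of `ℤ^N`. -/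
abbrev Laurent (m : ℕ) (K : Type*) [Field K] : Type _ := AddMonoidAlgebra K (Idx m → ℤ)

/-- The Witt algebra `W_N`: all `𝕂`-linear derivations of `A_N`, with the commutator bracket. -/
abbrev Witt (m : ℕ) (K : Type*) [Field K] : Type _ :=
  Derivation K (Laurent m K) (Laurent m K)

/-- The monomial `t^n`. -/
def mon {m : ℕ} (K : Type*) [Field K] (n : Idx m → ℤ) : Laurent m K :=
  AddMonoidAlgebra.single n 1

/-- The linear map underlying `t_i ∂/∂t_i`, sending `t^n` to `n_i t^n`. -/
def degLin {m : ℕ} (K : Type*) [Field K] (i : Idx m) : Laurent m K →ₗ[K] Laurent m K :=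
  (Finsupp.lsum K fun n : Idx m → ℤ => ((n i : ℤ) : K) • AddMonoidAlgebra.lsingle (R := K) n) ∘ₗ
    (AddMonoidAlgebra.coeffLinearEquiv K).toLinearMap

theorem degLin_single {m : ℕ} (K : Type*) [Field K] (i : Idx m) (n : Idx m → ℤ) (c : K) :
    degLin K i (AddMonoidAlgebra.single n c) = ((n i : ℤ) : K) • AddMonoidAlgebra.single n c := by
  simp [degLin]

/-- The degree derivation `d_i = t_i ∂/∂t_i` of `A_N`. -/
def deg {m : ℕ} (K : Type*) [Field K] (i : Idx m) : Witt m K :=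
  Derivation.mk' (degLin K i) (by
    intro a b
    induction a using AddMonoidAlgebra.induction_linear with
    | zero => simp
    | add a₁ a₂ h₁ h₂ => simp only [add_mul, map_add, h₁, h₂, smul_eq_mul, mul_add]; ring
    | single r c =>
      induction b using AddMonoidAlgebra.induction_linear with
      | zero => simp
      | add b₁ b₂ h₁ h₂ => simp only [add_mul, map_add, h₁, h₂, smul_eq_mul, mul_add]; ring
      | single s d =>
        simp only [AddMonoidAlgebra.single_mul_single, degLin_single, smul_eq_mul,
          Algebra.mul_smul_comm, add_comm s r, mul_comm d c, Pi.add_apply, Int.cast_add, add_smul]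
        exact add_comm _ _)

theorem deg_mon {m : ℕ} (K : Type*) [Field K] (i : Idx m) (n : Idx m → ℤ) :
    deg K i (mon K n) = ((n i : ℤ) : K) • mon K n :=
  degLin_single K i n 1

/-- The derivation `D(u, r) = ∑ᵢ uᵢ t^r dᵢ`. -/
def D {m : ℕ} {K : Type*} [Field K] (u : Idx m → K) (r : Idx m → ℤ) : Witt m K :=
  ∑ i, u i • (mon K r • deg K i)

/-- The pairing `(u, r) = ∑ᵢ uᵢ rᵢ` of `u ∈ 𝕂^N` with `r ∈ ℤ^N ⊂ 𝕂^N`. -/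
def pair {m : ℕ} {K : Type*} [Field K] (u : Idx m → K) (r : Idx m → ℤ) : K :=
  ∑ i, u i * ((r i : ℤ) : K)

/-- The vector `r̄ = J r = (r_{m+1}, …, r_{2m}, -r_1, …, -r_m)`. -/
def bar {m : ℕ} (r : Idx m → ℤ) : Idx m → ℤ :=
  Sum.elim (fun i => r (Sum.inr i)) (fun i => -r (Sum.inl i))

/-- The Hamiltonian vector field `h_r = D(r̄, r)`. -/
def h {m : ℕ} (K : Type*) [Field K] (r : Idx m → ℤ) : Witt m K :=
  D (fun i => ((bar r i : ℤ) : K)) r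

theorem D_mon {m : ℕ} {K : Type*} [Field K] (u : Idx m → K) (r n : Idx m → ℤ) :
    D u r (mon K n) = pair u n • mon K (r + n) := by
  have e : ∀ (S : Finset (Idx m)),
      (∑ i ∈ S, u i • (mon K r • deg K i)) (mon K n) =
        (∑ i ∈ S, u i * ((n i : ℤ) : K)) • mon K (r + n) := by
    intro S
    induction S using Finset.cons_induction with
    | empty => simp
    | cons i S hi ih =>
      rw [Finset.sum_cons, Finset.sum_cons, Derivation.add_apply, ih, add_smul,
        Derivation.smul_apply, Derivation.smul_apply, deg_mon, smul_eq_mul,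
        Algebra.mul_smul_comm, smul_smul]
      simp [mon, AddMonoidAlgebra.single_mul_single]
  exact e Finset.univ

theorem witt_ext {m : ℕ} {K : Type*} [Field K] {X Y : Witt m K}
    (H : ∀ n : Idx m → ℤ, X (mon K n) = Y (mon K n)) : X = Y := by
  refine Derivation.ext fun a => ?_
  induction a using AddMonoidAlgebra.induction_linear with
  | zero => simp
  | add a b ha hb => rw [map_add, map_add, ha, hb]
  | single n c =>
    have e : (AddMonoidAlgebra.single n c : Laurent m K) = c • mon K n := by simp [mon]
    rw [e, Derivation.map_smul, Derivation.map_smul, H n]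

theorem pair_add_right {m : ℕ} {K : Type*} [Field K] (u : Idx m → K) (r s : Idx m → ℤ) :
    pair u (r + s) = pair u r + pair u s := by
  simp [pair, mul_add, Finset.sum_add_distrib]

/-- The bracket of `W_N`: `[D(u, r), D(v, s)] = D((u, s) v - (v, r) u, r + s)`. -/
theorem lie_D {m : ℕ} {K : Type*} [Field K] (u v : Idx m → K) (r s : Idx m → ℤ) :
    ⁅D u r, D v s⁆ = D (pair u s • v - pair v r • u) (r + s) := by
  refine witt_ext fun n => ?_
  have e : pair (pair u s • v - pair v r • u) n = pair u s * pair v n - pair v r * pair u n := by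
    simp only [pair, Pi.sub_apply, Pi.smul_apply, smul_eq_mul, sub_mul, Finset.sum_sub_distrib,
      mul_assoc, ← Finset.mul_sum]
  rw [Derivation.commutator_apply, D_mon, D_mon, Derivation.map_smul, Derivation.map_smul, D_mon,
    D_mon, D_mon, e, pair_add_right, pair_add_right, smul_smul, smul_smul,
    show r + (s + n) = r + s + n by abel, show s + (r + n) = r + s + n by abel, ← sub_smul]
  congr 1
  ring

theorem D_smul {m : ℕ} {K : Type*} [Field K] (c : K) (u : Idx m → K) (r : Idx m → ℤ) :
    D (c • u) r = c • D u r := by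
  simp [D, Finset.smul_sum, smul_smul]

theorem pair_bar_skew {m : ℕ} {K : Type*} [Field K] (r s : Idx m → ℤ) :
    pair (fun i => ((bar s i : ℤ) : K)) r = -pair (fun i => ((bar r i : ℤ) : K)) s := by
  simp only [pair, bar, Fintype.sum_sum_type, Sum.elim_inl, Sum.elim_inr, Int.cast_neg, neg_mul,
    Finset.sum_neg_distrib]
  simp only [mul_comm]
  ring

/-- `[h_r, h_s] = (r̄, s) h_{r+s}`. -/
theorem lie_h {m : ℕ} {K : Type*} [Field K] (r s : Idx m → ℤ) :
    ⁅h K r, h K s⁆ = pair (fun i => ((bar r i : ℤ) : K)) s • h K (r + s) := by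
  rw [h, h, lie_D, pair_bar_skew r s, h, ← D_smul]
  congr 1
  ext i
  rcases i with i | i <;> simp [bar] <;> ring

/-- `[D(u, 0), h_r] = (u, r) h_r`. -/
theorem lie_D_zero_h {m : ℕ} {K : Type*} [Field K] (u : Idx m → K) (r : Idx m → ℤ) :
    ⁅D u 0, h K r⁆ = pair u r • h K r := by
  have e : pair (fun i => ((bar r i : ℤ) : K)) (0 : Idx m → ℤ) = 0 := by simp [pair]
  rw [h, lie_D, e, zero_smul, sub_zero, zero_add, D_smul]

/-- `[D(u, 0), D(v, 0)] = 0`. -/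
theorem lie_D_zero {m : ℕ} {K : Type*} [Field K] (u v : Idx m → K) :
    ⁅(D u 0 : Witt m K), D v 0⁆ = 0 := by
  rw [lie_D]
  simp [pair, D]

/-- The spanning set `{h_r} ∪ {D(u, 0)}` of the Hamiltonian algebra. -/
def gens (m : ℕ) (K : Type*) [Field K] : Set (Witt m K) :=
  Set.range (fun r : Idx m → ℤ => h K r) ∪ Set.range (fun u : Idx m → K => D u 0)

theorem lie_gens {m : ℕ} {K : Type*} [Field K] {x y : Witt m K} (hx : x ∈ gens m K)
    (hy : y ∈ gens m K) : ⁅x, y⁆ ∈ Submodule.span K (gens m K) := by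
  have hh : ∀ r : Idx m → ℤ, h K r ∈ Submodule.span K (gens m K) := fun r =>
    Submodule.subset_span (Or.inl ⟨r, rfl⟩)
  rcases hx with ⟨r, rfl⟩ | ⟨u, rfl⟩ <;> rcases hy with ⟨s, rfl⟩ | ⟨v, rfl⟩
  · simp only [lie_h]
    exact Submodule.smul_mem _ _ (hh _)
  · simp only []
    rw [← lie_skew, lie_D_zero_h]
    exact neg_mem (Submodule.smul_mem _ _ (hh _))
  · simp only [lie_D_zero_h]
    exact Submodule.smul_mem _ _ (hh _)
  · simp only [lie_D_zero]
    exact Submodule.zero_mem _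

theorem lie_span {m : ℕ} {K : Type*} [Field K] {x y : Witt m K}
    (hx : x ∈ Submodule.span K (gens m K)) (hy : y ∈ Submodule.span K (gens m K)) :
    ⁅x, y⁆ ∈ Submodule.span K (gens m K) := by
  induction hx using Submodule.span_induction with
  | zero => exact (zero_lie (L := Witt m K) y).symm ▸ Submodule.zero_mem _
  | add a b _ _ ha hb => exact (add_lie a b y).symm ▸ Submodule.add_mem _ ha hb
  | smul c a _ ha => exact (smul_lie c a y).symm ▸ Submodule.smul_mem _ c ha
  | mem a ha =>
    induction hy using Submodule.span_induction with
    | zero => exact (lie_zero (M := Witt m K) a).symm ▸ Submodule.zero_mem _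
    | add b c _ _ hb hc => exact (lie_add a b c).symm ▸ Submodule.add_mem _ hb hc
    | smul c b _ hb => exact (lie_smul c a b).symm ▸ Submodule.smul_mem _ c hb
    | mem b hb => exact lie_gens ha hb

/-- The Hamiltonian Lie algebra `H_N = span{h_r | r ∈ ℤ^N} + 𝔥 ⊂ W_N`. -/
def Ham (m : ℕ) (K : Type*) [Field K] : LieSubalgebra K (Witt m K) :=
  { Submodule.span K (gens m K) with
    lie_mem' := fun hx hy => lie_span hx hy }

/-- The derived subalgebra `H_N' = [H_N, H_N]`. -/
abbrev Ham' (m : ℕ) (K : Type*) [Field K] : LieIdeal K (Ham m K) :=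
  ⁅(⊤ : LieIdeal K (Ham m K)), (⊤ : LieIdeal K (Ham m K))⁆

/-- The Cartan subalgebra `𝔥 = {D(u, 0) | u ∈ 𝕂^N}`, as a subalgebra of `H_N`. -/
def cartan (m : ℕ) (K : Type*) [Field K] : LieSubalgebra K (Ham m K) where
  carrier := {x | ∃ u : Idx m → K, (x : Witt m K) = D u 0}
  zero_mem' := ⟨0, by simp [D]⟩
  add_mem' := by
    rintro x y ⟨u, hu⟩ ⟨v, hv⟩
    exact ⟨u + v, by simp [hu, hv, D, add_smul, Finset.sum_add_distrib]⟩
  smul_mem' := by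
    rintro c x ⟨u, hu⟩
    exact ⟨c • u, by rw [D_smul, ← hu]; rfl⟩
  lie_mem' := by
    rintro x y ⟨u, hu⟩ ⟨v, hv⟩
    exact ⟨0, by rw [LieSubalgebra.coe_bracket, hu, hv, lie_D_zero]; simp [D]⟩

/-- The homogeneous component `(H_N')_r = 𝕂 h_r` of `H_N'` (zero for `r = 0`, since `h_0 = 0`). -/
def comp (m : ℕ) (K : Type*) [Field K] (r : Idx m → ℤ) : Submodule K (Ham' m K) where
  carrier := {x | ∃ c : K, ((x : Ham m K) : Witt m K) = c • h K r}
  zero_mem' := ⟨0, by simp⟩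
  add_mem' := by
    rintro x y ⟨c, hc⟩ ⟨d, hd⟩
    exact ⟨c + d, by simp [hc, hd, add_smul]⟩
  smul_mem' := by
    rintro a x ⟨c, hc⟩
    exact ⟨a * c, by simp [hc, mul_smul]⟩

/-- The adjoint action of `H_N` on its ideal `H_N'`: `adj x y = [x, y]`. -/
def adj (m : ℕ) (K : Type*) [Field K] :
    Ham m K →ₗ⁅K⁆ LieDerivation K (Ham' m K) (Ham' m K) where
  toFun x :=
    { toLinearMap := LieModule.toEnd K (Ham m K) (Ham' m K) x
      leibniz' := by
        intro a b
        apply Subtype.ext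
        change ⁅x, ⁅(a : Ham m K), (b : Ham m K)⁆⁆ =
          ⁅(a : Ham m K), ⁅x, (b : Ham m K)⁆⁆ - ⁅(b : Ham m K), ⁅x, (a : Ham m K)⁆⁆
        rw [leibniz_lie, ← lie_skew (b : Ham m K)]
        abel }
  map_add' x y := by ext a; simp
  map_smul' c x := by ext a; simp
  map_lie' := by
    intro x y
    ext a
    simp

/-- A derivation of `H_N'` is homogeneous of degree `r` if it maps `(H_N')_s` into
`(H_N')_{r+s}` for every `s`. -/
def HomDeg {m : ℕ} {K : Type*} [Field K] (r : Idx m → ℤ)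
    (d : LieDerivation K (Ham' m K) (Ham' m K)) : Prop :=
  ∀ s : Idx m → ℤ, ∀ x ∈ comp m K s, d x ∈ comp m K (r + s)

/-- The semidirect product `H_N' ⋊ 𝔥`, with `𝔥` acting on `H_N'` by the adjoint action. -/
abbrev Semi (m : ℕ) (K : Type*) [Field K] : Type _ :=
  LieAlgebra.SemiDirectSum (Ham' m K) (cartan m K) ((adj m K).comp (cartan m K).incl)

end HamTorus

end

noncomputable section

namespace HamTorus

/-! ### Functional equations for an alternating nondegenerate form. -/

section AlternatingForm

variable {V K : Type*} [AddCommGroup V] [Field K]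

/-! Put ω(r, s) = (r̄, s), so that [h_r, h_s] = ω(r, s) h_{r+s}; in characteristic zero ω is
alternating and nondegenerate on ℤ^N. A derivation d is determined by the coefficients f_q(s) of
h_{q+s} in d(h_s), and the Leibniz rule becomes a functional equation for each f_q separately.

For q = 0 the equation forces f_0 to be additive (`map_add_of_degree_zero`), so f_0(s) = (u, s),
which is the action of D(u, 0). For q ≠ 0 it forces f_q = a_q ω(q, ·)
(`exists_eq_mul_of_degree_ne_zero`), which is the action of a_q h_q. Only finitely many a_q are
nonzero: if a_q ≠ 0 then f_q(e_i) ≠ 0 for some standard basis vector e_i, while each d(h_{e_i}) is a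
finite sum. Hence d is the adjoint action of D(u, 0) + ∑ a_q h_q (`adj_surjective`).

The functionals `coef` read off these coefficients. They separate points of span{h_r} and vanish on
𝔥, which also gives injectivity of `adj` and directness of the sum in `semiHom_bijective`. -/

theorem exists_two_ne_zero {f g : V →+ K} (hf : ∃ x, f x ≠ 0) (hg : ∃ x, g x ≠ 0) :
    ∃ x, f x ≠ 0 ∧ g x ≠ 0 := by
  obtain ⟨x, hx⟩ := hf
  obtain ⟨y, hy⟩ := hg
  by_cases h1 : g x = 0
  · by_cases h2 : f y = 0
    · exact ⟨x + y, by simp [h2, hx], by simp [h1, hy]⟩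
    · exact ⟨y, h2, hy⟩
  · exact ⟨x, hx, h1⟩

/-- A group can be the union of three proper subgroups, as the Klein four-group is, so
characteristic zero matters here. -/
theorem exists_three_ne_zero [CharZero K] {f g k : V →+ K} (hf : ∃ x, f x ≠ 0)
    (hg : ∃ x, g x ≠ 0) (hk : ∃ x, k x ≠ 0) : ∃ x, f x ≠ 0 ∧ g x ≠ 0 ∧ k x ≠ 0 := by
  obtain ⟨x, hfx, hgx⟩ := exists_two_ne_zero hf hg
  obtain ⟨y, hy⟩ := hk
  by_cases h1 : k x = 0
  · by_contra! H
    -- On the line y + n • x the value of `k` is constantly k(y) ≠ 0, while `f` and `g` each vanish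
    -- for at most one n. So one of n = 0, 1, 2 works.
    have H' : ∀ n : ℕ, f y + n * f x = 0 ∨ g y + n * g x = 0 := by
      intro n
      have := H (y + n • x)
      simp only [map_add, map_nsmul, h1, nsmul_eq_mul, mul_zero, add_zero] at this
      by_contra! h
      exact hy (this h.1 h.2)
    have inj : ∀ {u v : K} {i j : ℕ}, v ≠ 0 → u + i * v = 0 → u + j * v = 0 → i = j := by
      intro u v i j hv hi hj
      exact Nat.cast_injective (mul_right_cancel₀ hv (by linear_combination hi - hj))
    rcases H' 0 with h | h <;> rcases H' 1 with h' | h' <;> rcases H' 2 with h'' | h'' <;>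
      first
      | exact absurd (inj hfx h h') (by decide)
      | exact absurd (inj hfx h h'') (by decide)
      | exact absurd (inj hfx h' h'') (by decide)
      | exact absurd (inj hgx h h') (by decide)
      | exact absurd (inj hgx h h'') (by decide)
      | exact absurd (inj hgx h' h'') (by decide)
  · exact ⟨x, hfx, hgx, h1⟩

variable [CharZero K] {ω : V →+ V →+ K}

/-- Derivations of degree zero: `c` is the function with `d h_s = c(s) h_s`. -/
theorem map_add_of_degree_zero (nd : ∀ s, s ≠ 0 → ∃ t, ω s t ≠ 0) (alt : ∀ s, ω s s = 0)
    {c : V → K} (c0 : c 0 = 0)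
    (H : ∀ s t, s + t ≠ 0 → ω s t * c (s + t) = ω s t * c s + ω s t * c t) (s t : V) :
    c (s + t) = c s + c t := by
  have key : ∀ s t, ω s t ≠ 0 → c (s + t) = c s + c t := by
    intro s t hst
    have hne : s + t ≠ 0 := by
      rintro h
      rw [eq_neg_of_add_eq_zero_right h, map_neg, alt, neg_zero] at hst
      exact hst rfl
    have := H s t hne
    rw [← mul_add] at this
    exact mul_left_cancel₀ hst this
  by_cases hs : s = 0
  · simp [hs, c0]
  by_cases ht : t = 0
  · simp [ht, c0]
  by_cases hst : s + t = 0
  -- Expand c(p) along p = -s + (s + p); both splittings used are non-orthogonal.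
  · obtain ⟨p, hp⟩ := nd s hs
    obtain rfl := eq_neg_of_add_eq_zero_right hst
    have h1 := key s p hp
    have h2 := key (-s) (s + p) (by simpa [alt] using hp)
    rw [neg_add_cancel_left] at h2
    rw [add_neg_cancel, c0]
    linear_combination h1 + h2
  -- For orthogonal s, t, expand c(s + t + p) in two ways with p orthogonal to none of s, t, s + t.
  · obtain ⟨p, h1, h2, h3⟩ := exists_three_ne_zero (nd s hs) (nd t ht) (nd (s + t) hst)
    by_cases h4 : ω s t = 0
    · have e1 := key (s + t) p h3
      have e2 := key t p h2
      have e3 := key s (t + p) (by simpa [h4] using h1)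
      rw [add_assoc] at e1
      linear_combination e3 + e2 - e1
    · exact key s t h4

/-- Derivations of degree `q ≠ 0`: `f` is the function with `d h_s = f(s) h_{q+s}`. -/
theorem exists_eq_mul_of_degree_ne_zero (nd : ∀ s, s ≠ 0 → ∃ t, ω s t ≠ 0)
    (alt : ∀ s, ω s s = 0) {q : V} (hq : q ≠ 0) {f : V → K} (f0 : f 0 = 0) (fq : f (-q) = 0)
    (H : ∀ s t, q + (s + t) ≠ 0 →
      ω s t * f (s + t) = f s * ω (q + s) t + f t * ω s (q + t)) :
    ∃ a, ∀ s, f s = a * ω q s := by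
  have skew : ∀ s t, ω s t = -ω t s := by
    intro s t
    have := alt (s + t)
    simp only [map_add, AddMonoidHom.add_apply, alt] at this
    linear_combination this
  have ne_of : ∀ s, ω q s ≠ 0 → ∀ k : ℤ, k • q + s ≠ 0 := by
    intro s hs k h
    apply hs
    have := congrArg (ω q) h
    simpa [alt] using this
  have H' : ∀ s t, ω q (s + t) ≠ 0 →
      ω s t * f (s + t) = f s * (ω s t + ω q t) + f t * (ω s t - ω q s) := by
    intro s t h
    have := H s t (by simpa using ne_of _ h 1)
    rw [map_add, map_add, AddMonoidHom.add_apply, skew s q] at this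
    linear_combination this
  -- Apply the equation to the pair (s + q, -q), where the term f(-q) drops out.
  have shift : ∀ s, ω q s ≠ 0 → f (s + q) = f s := by
    intro s hs
    have := H' (s + q) (-q) (by simpa using hs)
    simp only [add_neg_cancel_right, map_neg, fq, map_add, AddMonoidHom.add_apply, alt,
      skew s q] at this
    apply mul_left_cancel₀ hs
    linear_combination -this
  -- Replacing s by s + q changes only ω(s, t), by ω(q, t). Subtracting the two equations gives f(s
  -- + t) = f(s) + f(t), and substituting this back leaves the proportionality.
  have add : ∀ s t, ω q s ≠ 0 → ω q t ≠ 0 → ω q (s + t) ≠ 0 → f s * ω q t = f t * ω q s := by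
    intro s t hs ht hst
    have h1 := H' s t hst
    have h2 := H' (s + q) t (by simpa [alt] using hst)
    rw [add_right_comm, shift _ hst, shift _ hs] at h2
    simp only [map_add, AddMonoidHom.add_apply, alt] at h2
    have h3 : f (s + t) = f s + f t := by
      apply mul_left_cancel₀ ht
      linear_combination h2 - h1
    rw [h3] at h1
    linear_combination -h1
  have prop : ∀ s t, ω q s ≠ 0 → ω q t ≠ 0 → f s * ω q t = f t * ω q s := by
    intro s t hs ht
    by_cases hst : ω q (s + t) = 0
    -- When ω(q, s + t) = 0, compare s and t through 2s: ω(q, 3s) and ω(q, 2s + t) = ω(q, s) are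
    -- nonzero.
    · have h2 : (2 : K) ≠ 0 := two_ne_zero
      have hss : ω q (s + s) ≠ 0 := by
        rw [map_add, ← two_mul]; exact mul_ne_zero h2 hs
      have e1 := add s (s + s) hs hss (by
        rw [map_add, map_add]
        intro h
        exact hs (by linear_combination (1 / 3 : K) * h))
      have e2 := add (s + s) t hss ht (by
        rw [add_assoc, map_add, hst, add_zero]; exact hs)
      simp only [map_add] at e1 e2
      apply mul_left_cancel₀ (mul_ne_zero h2 hs)
      linear_combination ω q t * e1 + ω q s * e2
    · exact add s t hs ht hst
  obtain ⟨p, hp⟩ := nd q hq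
  refine ⟨f p / ω q p, fun s => ?_⟩
  by_cases hs : ω q s = 0
  · rw [hs, mul_zero]
    by_cases s0 : s = 0
    · rw [s0, f0]
    by_cases sq : q + s = 0
    · rw [eq_neg_of_add_eq_zero_right sq, fq]
    -- For s orthogonal to q, proportionality gives f(s + t) = f(t), and the equation reduces to
    -- f(s) ω(q + s, t) = 0.
    obtain ⟨t, ht, ht'⟩ := exists_two_ne_zero (nd q hq) (nd (q + s) sq)
    have h1 := H' s t (by simpa [hs] using ht)
    have h2 := prop t (s + t) ht (by simpa [hs] using ht)
    have h3 : f (s + t) = f t := by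
      apply mul_left_cancel₀ ht
      rw [map_add, hs, zero_add] at h2
      linear_combination -h2
    rw [h3, hs] at h1
    apply mul_left_cancel₀ ht'
    rw [map_add, AddMonoidHom.add_apply]
    linear_combination -h1
  · have := prop s p hs hp
    field_simp
    exact this

end AlternatingForm

/-! ### The symplectic pairing and the coefficient functionals. -/

variable {m : ℕ} {K : Type*} [Field K]

theorem h_zero : h K (0 : Idx m → ℤ) = 0 := by
  refine witt_ext fun n => ?_
  rw [h, D_mon]
  have : bar (0 : Idx m → ℤ) = 0 := by ext (i | i) <;> simp [bar]
  simp [this, pair]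

/-- The symplectic pairing `(r̄, s)` as a biadditive map. -/
def symp (m : ℕ) (K : Type*) [Field K] : (Idx m → ℤ) →+ (Idx m → ℤ) →+ K :=
  AddMonoidHom.mk' (fun r => AddMonoidHom.mk' (fun s => pair (fun i => ((bar r i : ℤ) : K)) s)
    (pair_add_right _)) (by
      intro r s
      refine AddMonoidHom.ext fun t => ?_
      change pair (fun i => ((bar (r + s) i : ℤ) : K)) t =
        pair (fun i => ((bar r i : ℤ) : K)) t + pair (fun i => ((bar s i : ℤ) : K)) t
      rw [pair_bar_skew t, pair_add_right, pair_bar_skew t, pair_bar_skew t]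
      ring)

theorem symp_apply (r s : Idx m → ℤ) :
    symp m K r s = pair (fun i => ((bar r i : ℤ) : K)) s := rfl

theorem symp_self (r : Idx m → ℤ) : symp m K r r = 0 := by
  rw [symp_apply]
  simp only [pair, bar, Fintype.sum_sum_type, Sum.elim_inl, Sum.elim_inr, Int.cast_neg, neg_mul,
    Finset.sum_neg_distrib]
  simp only [mul_comm]
  ring

/-- The value is a sum of squares of integers, namely of the coordinates of q̄. -/
theorem symp_bar_ne_zero [CharZero K] {q : Idx m → ℤ} (hq : q ≠ 0) : symp m K q (bar q) ≠ 0 := by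
  have e : symp m K q (bar q) = ((∑ i, bar q i * bar q i : ℤ) : K) := by
    simp [symp_apply, pair]
  rw [e, Int.cast_ne_zero]
  intro h0
  rw [Finset.sum_eq_zero_iff_of_nonneg fun i _ => mul_self_nonneg _] at h0
  apply hq
  ext (i | i)
  · simpa [bar] using h0 (Sum.inr i) (Finset.mem_univ _)
  · simpa [bar] using h0 (Sum.inl i) (Finset.mem_univ _)

theorem symp_nondegenerate [CharZero K] (q : Idx m → ℤ) (hq : q ≠ 0) : ∃ t, symp m K q t ≠ 0 :=
  ⟨bar q, symp_bar_ne_zero hq⟩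

/-- The coefficient of `h_q`, for `q ≠ 0`, in an element of the Hamiltonian algebra. -/
def coef (K : Type*) [Field K] (q : Idx m → ℤ) : Witt m K →ₗ[K] K where
  -- Test on t^{q̄}: h_p sends it to a multiple of t^{p+q̄}, so only p = q contributes, with factor
  -- ω(q, q̄). At q = 0 the division by zero returns 0, in keeping with h_0 = 0.
  toFun X := (X (mon K (bar q))).coeff (q + bar q) / symp m K q (bar q)
  map_add' X Y := by simp [add_div]
  map_smul' c X := by simp [mul_div_assoc]

theorem coef_apply (q : Idx m → ℤ) (X : Witt m K) :
    coef K q X = (X (mon K (bar q))).coeff (q + bar q) / symp m K q (bar q) := rfl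

theorem coef_zero (X : Witt m K) : coef K (0 : Idx m → ℤ) X = 0 := by
  simp [coef_apply]

theorem coef_h_self [CharZero K] {q : Idx m → ℤ} (hq : q ≠ 0) : coef K q (h K q) = 1 := by
  rw [coef_apply, h, D_mon, ← symp_apply]
  simp [mon, symp_bar_ne_zero hq]

theorem coef_h_of_ne {p q : Idx m → ℤ} (hpq : p ≠ q) : coef K q (h K p) = 0 := by
  rw [coef_apply, h, D_mon]
  simp [mon, hpq]

theorem coef_D_zero (q : Idx m → ℤ) (u : Idx m → K) : coef K q (D u 0) = 0 := by
  by_cases hq : q = 0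
  · rw [hq, coef_zero]
  · rw [coef_apply, D_mon]
    simp [mon, hq]

/-! ### The derived algebra is the span of the h_r. -/

/-- The span of the Hamiltonian vector fields `h_r`. -/
def hSpan (m : ℕ) (K : Type*) [Field K] : Submodule K (Witt m K) :=
  Submodule.span K (Set.range fun r : Idx m → ℤ => h K r)

theorem h_mem_hSpan (r : Idx m → ℤ) : h K r ∈ hSpan m K := Submodule.subset_span ⟨r, rfl⟩

theorem h_mem_Ham (r : Idx m → ℤ) : h K r ∈ Ham m K := Submodule.subset_span (Or.inl ⟨r, rfl⟩)

theorem D_zero_mem_Ham (u : Idx m → K) : D u 0 ∈ Ham m K :=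
  Submodule.subset_span (Or.inr ⟨u, rfl⟩)

theorem hSpan_le_Ham : hSpan m K ≤ (Ham m K).toSubmodule :=
  Submodule.span_mono Set.subset_union_left

theorem exists_eq_add_of_mem_Ham {x : Witt m K} (hx : x ∈ Ham m K) :
    ∃ y ∈ hSpan m K, ∃ u : Idx m → K, x = y + D u 0 := by
  change x ∈ Submodule.span K (gens m K) at hx
  induction hx using Submodule.span_induction with
  | zero => exact ⟨0, zero_mem _, 0, by simp [D]⟩
  | add a b _ _ ha hb =>
    obtain ⟨y, hy, u, rfl⟩ := ha
    obtain ⟨z, hz, v, rfl⟩ := hb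
    refine ⟨y + z, add_mem hy hz, u + v, ?_⟩
    simp only [D, Pi.add_apply, add_smul, Finset.sum_add_distrib]
    abel
  | smul c a _ ha =>
    obtain ⟨y, hy, u, rfl⟩ := ha
    exact ⟨c • y, Submodule.smul_mem _ _ hy, c • u, by rw [D_smul, smul_add]⟩
  | mem a ha =>
    rcases ha with ⟨r, rfl⟩ | ⟨u, rfl⟩
    · exact ⟨_, h_mem_hSpan r, 0, by simp [D]⟩
    · exact ⟨0, zero_mem _, u, by simp⟩

theorem witt_zero_lie (x : Witt m K) : ⁅(0 : Witt m K), x⁆ = 0 := zero_lie (L := Witt m K) x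

theorem witt_lie_zero (x : Witt m K) : ⁅x, (0 : Witt m K)⁆ = 0 := lie_zero (M := Witt m K) x

theorem witt_add_lie (x y z : Witt m K) : ⁅x + y, z⁆ = ⁅x, z⁆ + ⁅y, z⁆ :=
  add_lie (M := Witt m K) x y z

theorem witt_lie_add (x y z : Witt m K) : ⁅x, y + z⁆ = ⁅x, y⁆ + ⁅x, z⁆ :=
  lie_add (M := Witt m K) x y z

theorem witt_smul_lie (c : K) (x y : Witt m K) : ⁅c • x, y⁆ = c • ⁅x, y⁆ :=
  smul_lie (M := Witt m K) c x y

theorem witt_lie_smul (c : K) (x y : Witt m K) : ⁅x, c • y⁆ = c • ⁅x, y⁆ :=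
  lie_smul (M := Witt m K) c x y

theorem witt_lie_skew (x y : Witt m K) : -⁅y, x⁆ = ⁅x, y⁆ := lie_skew (L := Witt m K) x y

theorem lie_h_mem_hSpan {x : Witt m K} (hx : x ∈ Ham m K) (s : Idx m → ℤ) :
    ⁅x, h K s⁆ ∈ hSpan m K := by
  change x ∈ Submodule.span K (gens m K) at hx
  induction hx using Submodule.span_induction with
  | zero => rw [witt_zero_lie]; exact zero_mem _
  | add a b _ _ ha hb => rw [witt_add_lie]; exact add_mem ha hb
  | smul c a _ ha => rw [witt_smul_lie]; exact Submodule.smul_mem _ _ ha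
  | mem a ha =>
    rcases ha with ⟨r, rfl⟩ | ⟨u, rfl⟩
    · simp only [lie_h]
      exact Submodule.smul_mem _ _ (h_mem_hSpan _)
    · simp only [lie_D_zero_h]
      exact Submodule.smul_mem _ _ (h_mem_hSpan _)

theorem lie_mem_hSpan {x y : Witt m K} (hx : x ∈ Ham m K) (hy : y ∈ hSpan m K) :
    ⁅x, y⁆ ∈ hSpan m K := by
  induction hy using Submodule.span_induction with
  | zero => rw [witt_lie_zero]; exact zero_mem _
  | add a b _ _ ha hb => rw [witt_lie_add]; exact add_mem ha hb
  | smul c a _ ha => rw [witt_lie_smul]; exact Submodule.smul_mem _ _ ha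
  | mem a ha =>
    obtain ⟨r, rfl⟩ := ha
    exact lie_h_mem_hSpan hx r

theorem lie_Ham_mem_hSpan {x y : Witt m K} (hx : x ∈ Ham m K) (hy : y ∈ Ham m K) :
    ⁅x, y⁆ ∈ hSpan m K := by
  obtain ⟨a, ha, u, rfl⟩ := exists_eq_add_of_mem_Ham hx
  obtain ⟨b, hb, v, rfl⟩ := exists_eq_add_of_mem_Ham hy
  rw [witt_lie_add, witt_add_lie _ _ (D v 0), lie_D_zero, add_zero, ← witt_lie_skew a]
  exact add_mem (lie_mem_hSpan hx hb) (neg_mem (lie_mem_hSpan (D_zero_mem_Ham v) ha))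

theorem mem_hSpan_of_mem_Ham' {x : Ham m K} (hx : x ∈ Ham' m K) : (x : Witt m K) ∈ hSpan m K := by
  rw [← LieSubmodule.mem_toSubmodule, LieSubmodule.lieIdeal_oper_eq_linear_span'] at hx
  induction hx using Submodule.span_induction with
  | zero => exact zero_mem _
  | add a b _ _ ha hb => exact add_mem ha hb
  | smul c a _ ha => exact Submodule.smul_mem _ _ ha
  | mem a ha =>
    obtain ⟨x, -, y, -, rfl⟩ := ha
    exact lie_Ham_mem_hSpan x.2 y.2

/-- For r ≠ 0, h_r is an eigenvector of ad D(r, 0) with eigenvalue ∑ r_i² ≠ 0, hence a commutator up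
to scale. -/
theorem h_mem_Ham' [CharZero K] (r : Idx m → ℤ) :
    (⟨h K r, h_mem_Ham r⟩ : Ham m K) ∈ Ham' m K := by
  by_cases hr : r = 0
  · have : (⟨h K r, h_mem_Ham r⟩ : Ham m K) = 0 := Subtype.ext (by rw [hr]; exact h_zero)
    rw [this]
    exact zero_mem _
  · have hp : pair (fun i => (r i : K)) r ≠ 0 := by
      have e : pair (fun i => (r i : K)) r = ((∑ i, r i * r i : ℤ) : K) := by simp [pair]
      rw [e, Int.cast_ne_zero]
      intro h0
      rw [Finset.sum_eq_zero_iff_of_nonneg fun i _ => mul_self_nonneg _] at h0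
      exact hr (funext fun i => by simpa using h0 i (Finset.mem_univ _))
    have e : (⟨h K r, h_mem_Ham r⟩ : Ham m K) = (pair (fun i => (r i : K)) r)⁻¹ •
        ⁅(⟨D _ 0, D_zero_mem_Ham fun i => (r i : K)⟩ : Ham m K), ⟨h K r, h_mem_Ham r⟩⁆ := by
      refine Subtype.ext ?_
      change h K r = (pair (fun i => (r i : K)) r)⁻¹ • ⁅D (fun i => (r i : K)) 0, h K r⁆
      rw [lie_D_zero_h, inv_smul_smul₀ hp]
    rw [e]
    exact (Ham' m K).smul_mem _ (LieSubmodule.lie_mem_lie (LieSubmodule.mem_top _)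
      (LieSubmodule.mem_top _))

theorem mem_Ham'_of_mem_hSpan [CharZero K] {x : Witt m K} (hx : x ∈ hSpan m K) :
    (⟨x, hSpan_le_Ham hx⟩ : Ham m K) ∈ Ham' m K := by
  have : hSpan m K ≤ (Ham' m K).toSubmodule.map (Ham m K).toSubmodule.subtype := by
    refine Submodule.span_le.2 ?_
    rintro _ ⟨r, rfl⟩
    exact ⟨_, h_mem_Ham' r, rfl⟩
  obtain ⟨y, hy, rfl⟩ := this hx
  exact hy

/-! ### Elements of the span are separated by their coefficients. -/

theorem eq_zero_of_coef_eq_zero [CharZero K] {x : Witt m K} (hx : x ∈ hSpan m K)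
    (H : ∀ q, coef K q x = 0) : x = 0 := by
  obtain ⟨f, rfl⟩ := Finsupp.mem_span_range_iff_exists_finsupp.1 hx
  refine Finset.sum_eq_zero fun q hq => ?_
  by_cases q0 : q = 0
  · simp [q0, h_zero]
  · have := H q
    rw [Finsupp.sum, map_sum, Finset.sum_eq_single_of_mem q hq] at this
    · rw [map_smul, coef_h_self q0, smul_eq_mul, mul_one] at this
      simp [this]
    · intro p _ hp
      rw [map_smul, coef_h_of_ne hp, smul_zero]

theorem eq_of_coef_eq [CharZero K] {x y : Witt m K} (hx : x ∈ hSpan m K) (hy : y ∈ hSpan m K)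
    (H : ∀ q, coef K q x = coef K q y) : x = y :=
  sub_eq_zero.1 (eq_zero_of_coef_eq_zero (sub_mem hx hy) fun q => by rw [map_sub, H, sub_self])

theorem finite_coef_ne_zero {x : Witt m K} (hx : x ∈ hSpan m K) :
    {q : Idx m → ℤ | coef K q x ≠ 0}.Finite := by
  obtain ⟨f, rfl⟩ := Finsupp.mem_span_range_iff_exists_finsupp.1 hx
  refine f.support.finite_toSet.subset fun q hq => ?_
  by_contra hf
  apply hq
  rw [Finsupp.sum, map_sum]
  refine Finset.sum_eq_zero fun p hp => ?_
  rw [map_smul, coef_h_of_ne (by rintro rfl; exact hf hp), smul_zero]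

theorem coef_lie_h [CharZero K] {x : Witt m K} (hx : x ∈ hSpan m K) (q t : Idx m → ℤ)
    (hqt : q + t ≠ 0) : coef K (q + t) ⁅x, h K t⁆ = symp m K q t * coef K q x := by
  induction hx using Submodule.span_induction with
  | zero => rw [witt_zero_lie]; simp
  | add a b _ _ ha hb => rw [witt_add_lie, map_add, map_add, ha, hb, mul_add]
  | smul c a _ ha => rw [witt_smul_lie, map_smul, map_smul, ha, smul_eq_mul, smul_eq_mul]; ring
  | mem a ha =>
    obtain ⟨p, rfl⟩ := ha
    simp only [lie_h, map_smul, ← symp_apply, smul_eq_mul]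
    by_cases hpq : p = q
    · rw [hpq, coef_h_self hqt]
      by_cases q0 : q = 0
      · simp [q0]
      · rw [coef_h_self q0]
    · rw [coef_h_of_ne (by simpa using hpq), coef_h_of_ne hpq]
      simp

theorem pair_single (u : Idx m → K) (i : Idx m) : pair u (Pi.single i 1) = u i := by
  simp [pair, Pi.single_apply]

/-! ### Coefficients of derivations. -/

/-- `h_r` as an element of the derived algebra. -/
def h' [CharZero K] (r : Idx m → ℤ) : Ham' m K := ⟨⟨h K r, h_mem_Ham r⟩, h_mem_Ham' r⟩

theorem coe_h' [CharZero K] (r : Idx m → ℤ) : (((h' r : Ham' m K) : Ham m K) : Witt m K) = h K r :=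
  rfl

theorem coe_mem_hSpan (x : Ham' m K) : ((x : Ham m K) : Witt m K) ∈ hSpan m K :=
  mem_hSpan_of_mem_Ham' x.2

theorem coe_adj (x : Ham m K) (y : Ham' m K) :
    ((adj m K x y : Ham m K) : Witt m K) = ⁅(x : Witt m K), ((y : Ham m K) : Witt m K)⁆ := rfl

theorem derivation_ext [CharZero K] {d e : LieDerivation K (Ham' m K) (Ham' m K)}
    (H : ∀ s : Idx m → ℤ, d (h' s) = e (h' s)) : d = e := by
  ext1 ⟨⟨y, hy⟩, hy'⟩
  obtain ⟨f, rfl⟩ := Finsupp.mem_span_range_iff_exists_finsupp.1 (mem_hSpan_of_mem_Ham' hy')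
  have e1 : (⟨⟨f.sum fun i a => a • h K i, hy⟩, hy'⟩ : Ham' m K) =
      f.sum fun i a => a • h' i := by
    refine Subtype.ext (Subtype.ext ?_)
    simp [Finsupp.sum, coe_h']
  rw [e1, Finsupp.sum, map_sum, map_sum]
  refine Finset.sum_congr rfl fun s _ => ?_
  rw [map_smul, map_smul, H]

/-- The degree-q part of the Leibniz rule for [h_s, h_t]. Degree q + s + t = 0 is excluded because
`coef` carries no information there. -/
theorem coef_derivation_lie [CharZero K] (d : LieDerivation K (Ham' m K) (Ham' m K))
    (q s t : Idx m → ℤ) (hq : q + (s + t) ≠ 0) :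
    symp m K s t * coef K (q + (s + t)) (d (h' (s + t)) : Ham m K) =
      coef K (q + s) (d (h' s) : Ham m K) * symp m K (q + s) t +
      coef K (q + t) (d (h' t) : Ham m K) * symp m K s (q + t) := by
  have e : ⁅(h' s : Ham' m K), (h' t : Ham' m K)⁆ = symp m K s t • (h' (s + t) : Ham' m K) := by
    refine Subtype.ext (Subtype.ext ?_)
    exact lie_h (K := K) s t
  have e2 := congrArg (fun x : Ham' m K => coef K (q + (s + t)) ((x : Ham m K) : Witt m K))
    (d.apply_lie_eq_sub (h' s) (h' t))
  have e3 : ∀ x y : Ham' m K, ((⁅x, y⁆ : Ham' m K) : Ham m K) =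
      (⁅((x : Ham m K) : Witt m K), ((y : Ham m K) : Witt m K)⁆ : Witt m K) := fun _ _ => rfl
  have e4 := coef_lie_h (coe_mem_hSpan (d (h' s))) (q + s) t (by rwa [add_assoc])
  have e5 := coef_lie_h (coe_mem_hSpan (d (h' t))) (q + t) s (by rwa [add_assoc, add_comm t])
  rw [add_assoc] at e4 e5
  rw [add_comm t s] at e5
  have skew : symp m K s (q + t) = - symp m K (q + t) s := by
    rw [symp_apply, pair_bar_skew, symp_apply]
  simp only [e, map_smul, AddSubgroupClass.coe_sub, map_sub, e3, coe_h'] at e2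
  rw [← witt_lie_skew (h K s), ← witt_lie_skew (h K t), map_neg, map_neg, e4, e5] at e2
  rw [skew]
  have e6 : coef K (q + (s + t)) ((symp m K s t • d (h' (s + t)) : Ham' m K) : Ham m K) =
    symp m K s t * coef K (q + (s + t)) (d (h' (s + t)) : Ham m K) := map_smul (coef K _) _ _
  linear_combination e2 - e6

theorem sum_single_eq (s : Idx m → ℤ) : ∑ i, s i • (Pi.single i 1 : Idx m → ℤ) = s := by
  ext j
  simp [Finset.sum_apply, Pi.single_apply]

/-- The degree `q` part of a derivation, evaluated at `h_s`. -/
def dcoef [CharZero K] (d : LieDerivation K (Ham' m K) (Ham' m K)) (q s : Idx m → ℤ) : K :=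
  coef K (q + s) (d (h' s) : Ham m K)

theorem dcoef_zero_right [CharZero K] (d : LieDerivation K (Ham' m K) (Ham' m K))
    (q : Idx m → ℤ) : dcoef d q 0 = 0 := by
  have : (h' 0 : Ham' m K) = 0 := Subtype.ext (Subtype.ext h_zero)
  rw [dcoef, this, map_zero]
  exact map_zero _

theorem exists_dcoef_eq_symp [CharZero K] (d : LieDerivation K (Ham' m K) (Ham' m K))
    {q : Idx m → ℤ} (hq : q ≠ 0) : ∃ a, ∀ s, dcoef d q s = a * symp m K q s :=
  exists_eq_mul_of_degree_ne_zero symp_nondegenerate symp_self hq (dcoef_zero_right d q)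
    (by rw [dcoef, add_neg_cancel, coef_zero]) (coef_derivation_lie d q)

theorem exists_dcoef_eq_pair [CharZero K] (d : LieDerivation K (Ham' m K) (Ham' m K)) :
    ∃ u : Idx m → K, ∀ s, dcoef d 0 s = pair u s := by
  have add := map_add_of_degree_zero (ω := symp m K) symp_nondegenerate symp_self
    (dcoef_zero_right d 0) (by
      intro s t hst
      have := coef_derivation_lie d 0 s t (by rwa [zero_add])
      simp only [dcoef]
      rw [zero_add s, zero_add t] at this
      rw [zero_add s, zero_add t]
      linear_combination this)
  let F : (Idx m → ℤ) →+ K := AddMonoidHom.mk' (dcoef d 0) add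
  refine ⟨fun i => F (Pi.single i 1), fun s => ?_⟩
  change F s = _
  conv_lhs => rw [← sum_single_eq s, map_sum]
  refine Finset.sum_congr rfl fun i _ => ?_
  rw [map_zsmul, zsmul_eq_mul, mul_comm]

theorem derivation_ext_dcoef [CharZero K] {d e : LieDerivation K (Ham' m K) (Ham' m K)}
    (H : ∀ q s, dcoef d q s = dcoef e q s) : d = e := by
  refine derivation_ext fun s => Subtype.ext (Subtype.ext ?_)
  refine eq_of_coef_eq (coe_mem_hSpan _) (coe_mem_hSpan _) fun q => ?_
  have := H (q - s) s
  rwa [dcoef, dcoef, sub_add_cancel] at this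

theorem dcoef_adj [CharZero K] {x : Ham m K} {y : Witt m K} (hy : y ∈ hSpan m K)
    {u : Idx m → K} (hx : (x : Witt m K) = y + D u 0) (q s : Idx m → ℤ) :
    dcoef (adj m K x) q s =
      coef K q y * symp m K q s + if q = 0 then pair u s else 0 := by
  rw [dcoef, coe_adj, hx, coe_h', witt_add_lie, map_add, lie_D_zero_h, map_smul, smul_eq_mul]
  by_cases hqs : q + s = 0
  · obtain rfl := eq_neg_of_add_eq_zero_right hqs
    rw [hqs, coef_zero, coef_zero, map_neg, symp_self]
    split_ifs with hq
    · simp [hq, pair]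
    · simp
  · rw [coef_lie_h hy q s hqs, mul_comm]
    split_ifs with hq
    · have : s ≠ 0 := by rintro rfl; simp [hq] at hqs
      rw [hq, zero_add, coef_h_self this, mul_one]
    · rw [coef_h_of_ne (by simpa using hq), mul_zero]

theorem finite_dcoef_ne_zero [CharZero K] (d : LieDerivation K (Ham' m K) (Ham' m K))
    (s : Idx m → ℤ) : {q | dcoef d q s ≠ 0}.Finite :=
  (finite_coef_ne_zero (coe_mem_hSpan (d (h' s)))).preimage (add_left_injective s).injOn

/-! ### The adjoint action is bijective. -/

theorem exists_single_symp_ne_zero [CharZero K] {q : Idx m → ℤ} (hq : q ≠ 0) :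
    ∃ i, symp m K q (Pi.single i 1) ≠ 0 := by
  obtain ⟨t, ht⟩ := symp_nondegenerate (K := K) q hq
  by_contra! H
  apply ht
  rw [← sum_single_eq t, map_sum]
  exact Finset.sum_eq_zero fun i _ => by rw [map_zsmul, H, smul_zero]

theorem exists_coef_eq [CharZero K] {a : (Idx m → ℤ) → K} (ha : {q | a q ≠ 0}.Finite) :
    ∃ y ∈ hSpan m K, ∀ q, q ≠ 0 → coef K q y = a q := by
  refine ⟨∑ q ∈ ha.toFinset, a q • h K q,
    sum_mem fun q _ => Submodule.smul_mem _ _ (h_mem_hSpan q), fun q hq => ?_⟩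
  rw [map_sum, Finset.sum_eq_single q]
  · rw [map_smul, coef_h_self hq, smul_eq_mul, mul_one]
  · intro p _ hp
    rw [map_smul, coef_h_of_ne hp, smul_zero]
  · intro h0
    simp only [Set.Finite.mem_toFinset, Set.mem_ofPred_eq, not_not] at h0
    rw [h0, zero_smul, map_zero]

theorem adj_surjective [CharZero K] : Function.Surjective (adj m K) := by
  intro d
  obtain ⟨u, hu⟩ := exists_dcoef_eq_pair d
  have H : ∀ q : Idx m → ℤ, ∃ a, q ≠ 0 → ∀ s, dcoef d q s = a * symp m K q s := by
    intro q
    by_cases hq : q = 0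
    · exact ⟨0, fun h => absurd hq h⟩
    · obtain ⟨a, ha⟩ := exists_dcoef_eq_symp d hq
      exact ⟨a, fun _ => ha⟩
  choose a ha using H
  have fin : {q | a q ≠ 0}.Finite := by
    -- The point 0 is added since the chosen a(0) is unconstrained.
    refine ((Set.finite_singleton 0).union
      (Set.finite_iUnion fun i => finite_dcoef_ne_zero d (Pi.single i 1))).subset fun q haq => ?_
    by_cases hq : q = 0
    · exact Or.inl hq
    · obtain ⟨i, hi⟩ := exists_single_symp_ne_zero (K := K) hq
      refine Or.inr (Set.mem_iUnion.2 ⟨i, ?_⟩)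
      rw [Set.mem_ofPred_eq, ha q hq]
      exact mul_ne_zero haq hi
  obtain ⟨y, hy, hya⟩ := exists_coef_eq fin
  refine ⟨⟨y + D u 0, add_mem (hSpan_le_Ham hy) (D_zero_mem_Ham u)⟩, ?_⟩
  refine derivation_ext_dcoef fun q s => ?_
  rw [dcoef_adj hy rfl]
  split_ifs with hq
  · simp [hq, hu]
  · rw [hya q hq, add_zero, ha q hq]

theorem adj_injective [CharZero K] : Function.Injective (adj m K) := by
  rw [← LieHom.coe_toLinearMap, injective_iff_map_eq_zero]
  intro x hx
  obtain ⟨y, hy, u, hxy⟩ := exists_eq_add_of_mem_Ham x.2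
  have H : ∀ q s, coef K q y * symp m K q s + (if q = 0 then pair u s else 0) = 0 := by
    intro q s
    rw [← dcoef_adj hy hxy, dcoef]
    change adj m K x = 0 at hx
    rw [hx]
    exact map_zero _
  -- Degree 0 detects u on the basis vectors; degree q ≠ 0 detects the coefficient of h_q on h_{q̄}.
  have hu : u = 0 := by
    ext i
    simpa [pair_single, coef_zero] using H 0 (Pi.single i 1)
  have hy0 : y = 0 := by
    refine eq_zero_of_coef_eq_zero hy fun q => ?_
    by_cases hq : q = 0
    · rw [hq, coef_zero]
    · simpa [hq, symp_bar_ne_zero hq] using H q (bar q)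
  refine Subtype.ext ?_
  rw [hxy, hy0, hu]
  simp [D]

/-! ### Homogeneous derivations. -/

theorem comp_coef_eq_zero {q r : Idx m → ℤ} {x : Ham' m K} (hx : x ∈ comp m K r) (hq : q ≠ r) :
    coef K q (x : Ham m K) = 0 := by
  obtain ⟨c, hc⟩ := hx
  rw [hc, map_smul, coef_h_of_ne hq.symm, smul_zero]

theorem h'_mem_comp [CharZero K] (r : Idx m → ℤ) : h' r ∈ comp m K r :=
  ⟨1, by rw [one_smul, coe_h']⟩

theorem dcoef_eq_zero_of_homDeg [CharZero K] {d : LieDerivation K (Ham' m K) (Ham' m K)}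
    {r q : Idx m → ℤ} (hd : HomDeg r d) (hq : q ≠ r) (s : Idx m → ℤ) : dcoef d q s = 0 :=
  comp_coef_eq_zero (hd s _ (h'_mem_comp s)) (by simpa using hq)

theorem homDeg_iff_of_ne_zero [CharZero K] {r : Idx m → ℤ} (hr : r ≠ 0)
    (d : LieDerivation K (Ham' m K) (Ham' m K)) :
    HomDeg r d ↔ ∃ x ∈ comp m K r, d = LieDerivation.ad K (Ham' m K) x := by
  constructor
  · intro hd
    obtain ⟨a, ha⟩ := exists_dcoef_eq_symp d hr
    have hx : a • h' r ∈ comp m K r := Submodule.smul_mem _ _ (h'_mem_comp r)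
    refine ⟨a • h' r, hx, ?_⟩
    have e : LieDerivation.ad K (Ham' m K) (a • h' r) =
        adj m K ((a • h' r : Ham' m K) : Ham m K) := by
      ext1 y
      rw [LieDerivation.ad_apply_apply]
      rfl
    rw [e]
    refine derivation_ext_dcoef fun q s => ?_
    rw [dcoef_adj (u := 0) (coe_mem_hSpan (a • h' r)) (by simp [D])]
    have e2 : (if q = 0 then pair (0 : Idx m → K) s else 0) = 0 := by simp [pair]
    rw [e2, add_zero]
    by_cases hq : q = r
    · rw [hq, ha]
      have : coef K r ((a • h' r : Ham' m K) : Ham m K) = a * coef K r (h K r) :=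
        map_smul (coef K r) _ _
      rw [this, coef_h_self hr, mul_one]
    · rw [dcoef_eq_zero_of_homDeg hd hq, comp_coef_eq_zero hx hq, zero_mul]
  · rintro ⟨x, ⟨c, hc⟩, rfl⟩ s y ⟨b, hb⟩
    refine ⟨c * (b * symp m K r s), ?_⟩
    rw [LieDerivation.ad_apply_apply]
    change ⁅((x : Ham m K) : Witt m K), ((y : Ham m K) : Witt m K)⁆ = _
    rw [hc, hb, witt_smul_lie, witt_lie_smul, lie_h, ← symp_apply, smul_smul, smul_smul, mul_assoc]

theorem homDeg_zero_iff [CharZero K] (d : LieDerivation K (Ham' m K) (Ham' m K)) :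
    HomDeg 0 d ↔ ∃ x ∈ cartan m K, d = adj m K x := by
  constructor
  · intro hd
    obtain ⟨u, hu⟩ := exists_dcoef_eq_pair d
    refine ⟨⟨D u 0, D_zero_mem_Ham u⟩, ⟨u, rfl⟩, ?_⟩
    refine derivation_ext_dcoef fun q s => ?_
    rw [dcoef_adj (zero_mem _) (zero_add (D u 0)).symm, map_zero, zero_mul, zero_add]
    split_ifs with hq
    · rw [hq, hu]
    · exact dcoef_eq_zero_of_homDeg hd hq s
  · rintro ⟨x, ⟨u, hu⟩, rfl⟩ s y ⟨b, hb⟩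
    refine ⟨b * pair u s, ?_⟩
    rw [coe_adj, hu, hb, witt_lie_smul, lie_D_zero_h, zero_add, smul_smul]

/-! ### The semidirect product decomposition. -/

/-- The map `(x, y) ↦ x + y` from the semidirect product to the Hamiltonian algebra. -/
def semiHom (m : ℕ) (K : Type*) [Field K] : Semi m K →ₗ⁅K⁆ Ham m K where
  toFun z := (z.left : Ham m K) + (z.right : Ham m K)
  map_add' x y := add_add_add_comm (x.left : Ham m K) y.left x.right y.right
  map_smul' c x := (smul_add c (x.left : Ham m K) (x.right : Ham m K)).symm
  map_lie' := by
    intro x y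
    change ⁅(x.left : Ham m K), (y.left : Ham m K)⁆ + ⁅(x.right : Ham m K), (y.left : Ham m K)⁆ -
      ⁅(y.right : Ham m K), (x.left : Ham m K)⁆ + ⁅(x.right : Ham m K), (y.right : Ham m K)⁆ =
      ⁅(x.left : Ham m K) + (x.right : Ham m K), (y.left : Ham m K) + (y.right : Ham m K)⁆
    rw [lie_add, add_lie, add_lie, ← lie_skew (x.left : Ham m K) (y.right : Ham m K)]
    abel

theorem semiHom_bijective [CharZero K] : Function.Bijective (semiHom m K) := by
  constructor
  · rw [← LieHom.coe_toLinearMap, injective_iff_map_eq_zero]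
    intro z hz
    obtain ⟨u, hu⟩ := z.right.2
    have e : ((z.left : Ham m K) : Witt m K) + D u 0 = 0 := by
      rw [← hu]
      exact congrArg (Subtype.val : Ham m K → Witt m K) hz
    -- The left part equals -D(u, 0), on which every `coef` vanishes.
    have hl : ((z.left : Ham m K) : Witt m K) = 0 := by
      refine eq_zero_of_coef_eq_zero (coe_mem_hSpan _) fun q => ?_
      rw [eq_neg_of_add_eq_zero_left e, map_neg, coef_D_zero, neg_zero]
    rw [hl, zero_add] at e
    exact LieAlgebra.SemiDirectSum.ext (Subtype.ext (Subtype.ext hl))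
      (Subtype.ext (Subtype.ext (hu.trans e)))
  · intro x
    obtain ⟨y, hy, u, hxy⟩ := exists_eq_add_of_mem_Ham x.2
    exact ⟨⟨⟨_, mem_Ham'_of_mem_hSpan hy⟩, ⟨⟨D u 0, D_zero_mem_Ham u⟩, u, rfl⟩⟩,
      Subtype.ext hxy.symm⟩

end HamTorus

end

theorem theorem4p5 (K : Type*) [Field K] [CharZero K] [IsAlgClosed K] (m : ℕ) (hm : 1 ≤ m) :
    -- `H_N' ⋊ 𝔥 ≅ H_N` through `(x, y) ↦ x + y`
    (∃ f : HamTorus.Semi m K ≃ₗ⁅K⁆ HamTorus.Ham m K,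
      ∀ z : HamTorus.Semi m K,
        f z = (z.left : HamTorus.Ham m K) + (z.right : HamTorus.Ham m K)) ∧
    -- `H_N ≅ Der(H_N')` through the adjoint action on `H_N'`
    (∃ e : HamTorus.Ham m K ≃ₗ⁅K⁆ LieDerivation K (HamTorus.Ham' m K) (HamTorus.Ham' m K),
      ∀ (x : HamTorus.Ham m K) (y : HamTorus.Ham' m K),
        ((e x y : HamTorus.Ham' m K) : HamTorus.Ham m K) = ⁅x, (y : HamTorus.Ham m K)⁆) ∧
    -- every derivation of `H_N'` is the adjoint action of an element of `H_N`
    (∀ d : LieDerivation K (HamTorus.Ham' m K) (HamTorus.Ham' m K),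
      ∃ x : HamTorus.Ham m K, ∀ y : HamTorus.Ham' m K,
        ((d y : HamTorus.Ham' m K) : HamTorus.Ham m K) = ⁅x, (y : HamTorus.Ham m K)⁆) ∧
    -- `Der(H_N')_r = ad (H_N')_r` for `r ≠ 0`
    (∀ r : HamTorus.Idx m → ℤ, r ≠ 0 →
      ∀ d : LieDerivation K (HamTorus.Ham' m K) (HamTorus.Ham' m K),
        HamTorus.HomDeg r d ↔
          ∃ x ∈ HamTorus.comp m K r, d = LieDerivation.ad K (HamTorus.Ham' m K) x) ∧
    -- `Der(H_N')_0 = ad 𝔥`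
    (∀ d : LieDerivation K (HamTorus.Ham' m K) (HamTorus.Ham' m K),
      HamTorus.HomDeg 0 d ↔ ∃ x ∈ HamTorus.cartan m K, d = HamTorus.adj m K x) := by
  refine ⟨⟨LieEquiv.ofBijective (HamTorus.semiHom m K) HamTorus.semiHom_bijective, fun _ => rfl⟩,
    ⟨LieEquiv.ofBijective (HamTorus.adj m K) ⟨HamTorus.adj_injective, HamTorus.adj_surjective⟩,
      fun _ _ => rfl⟩, fun d => ?_, fun r hr d => HamTorus.homDeg_iff_of_ne_zero hr d,
    HamTorus.homDeg_zero_iff⟩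
  obtain ⟨x, rfl⟩ := HamTorus.adj_surjective d
  exact ⟨x, fun _ => rfl⟩
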